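/- Let $\Omega$ be a finite Galois extension of $\mathbb{Q}$ with Galois group $G$, let $K, K_1,\dots,K_\ell$ be subfields of $\Omega$, and let $H, J_1,\dots,J_\ell\le G$ be the subgroups fixing them. Assume that there is a generalised norm relation between $K$ and the $K_i$, that is, an equality in $\mathbb{Q}[G]$ $$N_H=\sum_{k=1}^{m} a_k\,N_{J_{i_k}}\,b_k,\qquad a_k,b_k\in\mathbb{Q}[G],\quad J_{i_k}\neq 1,$$ where $N_U=\sum_{u\in U}u$ for a subgroup $U\le G$. For each $i$, a compositum of $K_i$ and $K$ is a triple $(C,\iota_{K_i},\iota_K)$ of a number field $C$ and morphisms of $\mathbb{Q}$-algebras $\iota_{K_i}\colon K_i\to C$, $\iota_K\colon K\to C$ whose images generate $C$ as a ring; an isomorphism of compositums is a field isomorphism compatible with both morphisms. Let $\mathrm{Compos}(K_i,K)$ be a set of representatives of the compositums of $K_i$ and $K$ up to isomorphism. Embed $C$ into $\Omega$ so that $\iota_K$ becomes the inclusion of $K$, and let $g\in G$ be such that $\iota_{K_i}$ becomes the restriction of $g$ to $K_i$; the double coset $HgJ_i$ depends only on the compositum. The compositum acts by $$K_i^\times=(\Omega^\times)^{J_i}\longrightarrow(\Omega^\times)^{H}=K^\times,\qquad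 C\cdot x=\prod_{\delta\in G/J_i,\ H\delta J_i=HgJ_i}\delta(x).$$ Let $S$ be a (possibly infinite) set of nonzero prime ideals of $\mathcal{O}_K$ that contains, with a prime $\mathfrak{p}$, all the primes of $\mathcal{O}_K$ above the same prime number as $\mathfrak{p}$. Let $\mathcal{O}_{K,S}^\times$ be the group of $S$-units of $K$, and $\mathcal{O}_{K_i,S}^\times$ the group of $S_i$-units of $K_i$, where $S_i$ is the set of primes of $\mathcal{O}_{K_i}$ that lie above the prime numbers below the elements of $S$. Then the homomorphism (with all groups written additively) $$\Phi\colon\bigoplus_{i=1}^{\ell}\ \bigoplus_{C\in\mathrm{Compos}(K_i,K)}\mathcal{O}_{K_i,S}^\times\longrightarrow K^\times,\qquad (x_{i,C})\mapsto\sum_{i}\sum_{C} C\cdot x_{i,C}$$ takes its values in $\mathcal{O}_{K,S}^\times$, and its image has maximal rank in $\mathcal{O}_{K,S}^\times$: the image and $\mathcal{O}_{K,S}^\times$ have the same rank over $\mathbb{Z}$, and every element of $\mathcal{O}_{K,S}^\times$ has a positive power in the image. -/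

import Mathlib

open NumberField IsDedekindDomain
open scoped DirectSum

universe u

noncomputable section

/-! ### Generalised norm relations -/

/-- The norm element `N_H = ∑_{h ∈ H} h` of a subgroup `H` in the group algebra `R[G]`. -/
def normElement (R : Type*) [CommRing R] {G : Type*} [Group G] [Finite G] (H : Subgroup G) :
    MonoidAlgebra R G :=
  ∑ᶠ h : H, MonoidAlgebra.of R G (h : G)

/-- `G` admits a generalised norm relation over `R` with respect to `H` and the set `𝒥` of
subgroups: an equality `N_H = ∑ i, a_i N_{J_i} b_i` in `R[G]` with `a_i, b_i ∈ R[G]`,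
`J_i ∈ 𝒥` and `J_i ≠ 1`. -/
def AdmitsGenNormRelation (R : Type*) [CommRing R] {G : Type*} [Group G] [Finite G]
    (H : Subgroup G) (𝒥 : Set (Subgroup G)) : Prop :=
  ∃ (m : ℕ) (J : Fin m → Subgroup G) (a b : Fin m → MonoidAlgebra R G),
    (∀ i, J i ∈ 𝒥 ∧ J i ≠ ⊥) ∧
    normElement R H = ∑ i, a i * normElement R (J i) * b i

/-! ### Double coset operators -/

section Hecke

variable {G : Type*} [Group G] {V : Type*} [CommGroup V] [MulDistribMulAction G V]

/-- The element `δ x` of `V`, for a coset `δ ∈ G ⧸ H` and an `H`-fixed element `x`. -/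
def cosetSMul (H : Subgroup G) (x : FixedPoints.subgroup H V) (δ : G ⧸ H) : V :=
  Quotient.liftOn' δ (fun g => g • (x : V)) (by
    intro a b hab
    have h := x.2 (⟨a⁻¹ * b, QuotientGroup.leftRel_apply.mp hab⟩ : H)
    change (a⁻¹ * b) • (x : V) = x at h
    change a • (x : V) = b • (x : V)
    rw [mul_smul, inv_smul_eq_iff] at h
    exact h.symm)

@[simp]
theorem cosetSMul_mk (H : Subgroup G) (x : FixedPoints.subgroup H V) (g : G) :
    cosetSMul H x (g : G ⧸ H) = g • (x : V) := rfl

theorem cosetSMul_smul (H : Subgroup G) (x : FixedPoints.subgroup H V) (g : G) (δ : G ⧸ H) :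
    cosetSMul H x (g • δ) = g • cosetSMul H x δ := by
  induction δ using QuotientGroup.induction_on with
  | H a => exact mul_smul g a (x : V)

/-- The double coset `J δ H` of a coset `δ ∈ G ⧸ H`. -/
def cosetToDoubleCoset (J H : Subgroup G) (δ : G ⧸ H) :
    DoubleCoset.Quotient (J : Set G) (H : Set G) :=
  Quotient.liftOn' δ (fun g => DoubleCoset.mk J H g) (by
    intro a b hab
    exact (DoubleCoset.eq J H a b).mpr
      ⟨1, J.one_mem, a⁻¹ * b, QuotientGroup.leftRel_apply.mp hab, by group⟩)

@[simp]
theorem cosetToDoubleCoset_mk (J H : Subgroup G) (g : G) :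
    cosetToDoubleCoset J H (g : G ⧸ H) = DoubleCoset.mk J H g := rfl

theorem cosetToDoubleCoset_smul (J H : Subgroup G) (j : J) (δ : G ⧸ H) :
    cosetToDoubleCoset J H ((j : G) • δ) = cosetToDoubleCoset J H δ := by
  induction δ using QuotientGroup.induction_on with
  | H a =>
    exact ((DoubleCoset.eq J H a (j * a)).mpr ⟨j, j.2, 1, H.one_mem, by group⟩).symm

variable [Finite G]

/-- The operator `T_{JgH} : V^H → V^J`, `x ↦ ∏ δ x` over the cosets `δ ∈ G ⧸ H` with
`J δ H = J g H`. The `G`-module `V` is written multiplicatively. -/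
def heckeOperator (J H : Subgroup G) (D : DoubleCoset.Quotient (J : Set G) (H : Set G)) :
    FixedPoints.subgroup H V →* FixedPoints.subgroup J V where
  toFun x := ⟨∏ᶠ δ : {δ : G ⧸ H // cosetToDoubleCoset J H δ = D}, cosetSMul H x δ, by
    intro j
    change (j : G) • (∏ᶠ δ : {δ : G ⧸ H // cosetToDoubleCoset J H δ = D}, cosetSMul H x δ.1) =
      ∏ᶠ δ : {δ : G ⧸ H // cosetToDoubleCoset J H δ = D}, cosetSMul H x δ.1
    rw [← MulDistribMulAction.toMonoidHom_apply, MonoidHom.map_finprod _ (Set.toFinite _)]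
    let e : {δ : G ⧸ H // cosetToDoubleCoset J H δ = D} ≃
        {δ : G ⧸ H // cosetToDoubleCoset J H δ = D} :=
      (MulAction.toPerm (j : G)).subtypeEquiv (fun δ => by
        rw [MulAction.toPerm_apply, cosetToDoubleCoset_smul])
    exact finprod_eq_of_bijective e e.bijective
      (fun δ => (cosetSMul_smul H x (j : G) δ.1).symm)⟩
  map_one' := by
    ext
    change ∏ᶠ δ : {δ : G ⧸ H // cosetToDoubleCoset J H δ = D}, cosetSMul H 1 δ.1 = 1
    refine finprod_eq_one_of_forall_eq_one fun δ => ?_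
    obtain ⟨δ, -⟩ := δ
    induction δ using QuotientGroup.induction_on with
    | H a => exact smul_one a
  map_mul' x y := by
    ext
    change ∏ᶠ δ : {δ : G ⧸ H // cosetToDoubleCoset J H δ = D}, cosetSMul H (x * y) δ.1 =
      (∏ᶠ δ : {δ : G ⧸ H // cosetToDoubleCoset J H δ = D}, cosetSMul H x δ.1) *
      ∏ᶠ δ : {δ : G ⧸ H // cosetToDoubleCoset J H δ = D}, cosetSMul H y δ.1
    rw [← finprod_mul_distrib (Set.toFinite _) (Set.toFinite _)]
    refine finprod_congr fun δ => ?_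
    obtain ⟨δ, -⟩ := δ
    induction δ using QuotientGroup.induction_on with
    | H a => exact smul_mul' a (x : V) (y : V)

end Hecke

/-! ### Compositums -/

/-- A compositum `(C, ι_K, ι_L)` of two number fields `K` and `L`: a number field `C` with
`ℚ`-algebra morphisms `ι_K : K → C`, `ι_L : L → C` whose images generate `C` as a ring. -/
structure Compositum (K L : Type u) [Field K] [Algebra ℚ K] [Field L] [Algebra ℚ L] where
  /-- the underlying number field -/
  C : Type u
  [field : Field C]
  [numberField : NumberField C]
  /-- the embedding of `K` -/
  ιK : K →ₐ[ℚ] C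
  /-- the embedding of `L` -/
  ιL : L →ₐ[ℚ] C
  generates : Subring.closure (Set.range ιK ∪ Set.range ιL) = ⊤

attribute [instance] Compositum.field Compositum.numberField

namespace Compositum

section Iso

variable {K L : Type u} [Field K] [Algebra ℚ K] [Field L] [Algebra ℚ L]

/-- Isomorphism of compositums: a field isomorphism compatible with the two embeddings. -/
def IsIso (A B : Compositum K L) : Prop :=
  ∃ f : A.C ≃+* B.C, (∀ x, f (A.ιK x) = B.ιK x) ∧ ∀ y, f (A.ιL y) = B.ιL y

/-- `𝒞` is a set of representatives of the compositums of `K` and `L` up to isomorphism. -/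
def IsSetOfRepresentatives (𝒞 : Set (Compositum K L)) : Prop :=
  ∀ A : Compositum K L, ∃! B, B ∈ 𝒞 ∧ A.IsIso B

end Iso

section Action

variable {Ω : Type u} [Field Ω] [NumberField Ω] [IsGalois ℚ Ω]
  {K L : IntermediateField ℚ Ω} (A : Compositum K L)

/-- A compositum of two subfields `K`, `L` of `Ω` embeds into `Ω` over `L`. -/
theorem exists_embedding : ∃ f : A.C →ₐ[ℚ] Ω, ∀ y : L, f (A.ιL y) = y := by
  let _ : Algebra L A.C := A.ιL.toRingHom.toAlgebra
  have _ : IsScalarTower ℚ L A.C := IsScalarTower.of_algebraMap_eq fun q => (A.ιL.commutes q).symm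
  have hS : IntermediateField.adjoin L (Set.range A.ιK) = ⊤ := by
    rw [eq_top_iff]
    intro x _
    have hx : x ∈ Subring.closure (Set.range A.ιK ∪ Set.range A.ιL) := by
      rw [A.generates]; trivial
    have hle : Subring.closure (Set.range A.ιK ∪ Set.range A.ιL) ≤
        (IntermediateField.adjoin L (Set.range A.ιK)).toSubfield.toSubring := by
      rw [Subring.closure_le]
      rintro _ (h | ⟨y, rfl⟩)
      · exact IntermediateField.subset_adjoin L _ h
      · exact (IntermediateField.adjoin L (Set.range A.ιK)).algebraMap_mem y
    exact hle hx
  obtain ⟨f, hf⟩ := IntermediateField.exists_algHom_of_adjoin_splits' (F := ℚ) (K := Ω)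
    (E := A.C) (S := Set.range A.ιK) L.val (by
      rintro _ ⟨x, rfl⟩
      have hi : IsIntegral ℚ (A.ιK x) := Algebra.IsIntegral.isIntegral _
      refine ⟨hi.tower_top, hi.minpoly_splits_tower_top' ?_⟩
      have h1 : minpoly ℚ (A.ιK x) = minpoly ℚ (x : Ω) := by
        rw [minpoly.algHom_eq A.ιK A.ιK.injective]
        exact (minpoly.algHom_eq K.val K.val.injective x).symm
      rw [h1]
      convert! Normal.splits (inferInstance : Normal ℚ Ω) (x : Ω)) hS
  exact ⟨f, fun y => DFunLike.congr_fun hf y⟩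

/-- Every embedding of a subfield `K` of `Ω` into `Ω` is the restriction of some `g ∈ G`. -/
theorem exists_restriction (σ : K →ₐ[ℚ] Ω) : ∃ g : Ω ≃ₐ[ℚ] Ω, ∀ x : K, σ x = g x := by
  obtain ⟨g, hg⟩ := IntermediateField.exists_algHom_of_splits' (F := ℚ) (E := Ω) (K := Ω)
    σ (fun s => by
      have hi : IsIntegral ℚ s := Algebra.IsIntegral.isIntegral _
      refine ⟨hi.tower_top, hi.minpoly_splits_tower_top' ?_⟩
      convert! Normal.splits (inferInstance : Normal ℚ Ω) s
      exact Subsingleton.elim _ _)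
  exact ⟨AlgEquiv.ofBijective g (AlgHom.normal_bijective ℚ Ω Ω g),
    fun x => (DFunLike.congr_fun hg x).symm⟩

theorem exists_embedding_eq : ∃ g : Ω ≃ₐ[ℚ] Ω, ∃ f : A.C →ₐ[ℚ] Ω,
    (∀ y : L, f (A.ιL y) = y) ∧ ∀ x : K, f (A.ιK x) = g x := by
  obtain ⟨f, hf⟩ := A.exists_embedding
  obtain ⟨g, hg⟩ := exists_restriction (f.comp A.ιK)
  exact ⟨g, f, hf, hg⟩

/-- The double coset `J g H` attached to a compositum of `K` and `L`, where `H` and `J` fix `K`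
and `L`. Here `C` is embedded in `Ω` so that `ι_L` becomes the inclusion of `L`, and `g ∈ G` is
such that `ι_K` becomes the restriction of `g` to `K`. -/
def doubleCoset : DoubleCoset.Quotient (L.fixingSubgroup : Set (Ω ≃ₐ[ℚ] Ω))
    (K.fixingSubgroup : Set (Ω ≃ₐ[ℚ] Ω)) :=
  DoubleCoset.mk L.fixingSubgroup K.fixingSubgroup A.exists_embedding_eq.choose

/-- The double coset does not depend on the choices made. -/
theorem doubleCoset_eq (f : A.C →ₐ[ℚ] Ω) (hf : ∀ y : L, f (A.ιL y) = y) (g : Ω ≃ₐ[ℚ] Ω)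
    (hg : ∀ x : K, f (A.ιK x) = g x) :
    A.doubleCoset = DoubleCoset.mk L.fixingSubgroup K.fixingSubgroup g := by
  obtain ⟨f₀, hf₀, hg₀⟩ := A.exists_embedding_eq.choose_spec
  change DoubleCoset.mk _ _ A.exists_embedding_eq.choose = _
  generalize A.exists_embedding_eq.choose = g₀ at hg₀ ⊢
  let e : A.C ≃ₐ[ℚ] f₀.fieldRange := AlgEquiv.ofInjectiveField f₀
  obtain ⟨h, hh⟩ := exists_restriction (f.comp e.symm.toAlgHom)
  have hfh : ∀ c, f c = h (f₀ c) := fun c => by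
    have := hh (e c)
    change f (e.symm (e c)) = _ at this
    rw [e.symm_apply_apply] at this
    exact this
  have h1 : h ∈ L.fixingSubgroup := by
    rw [IntermediateField.mem_fixingSubgroup_iff]
    intro y hy
    have := hfh (A.ιL ⟨y, hy⟩)
    rw [hf, hf₀] at this
    exact this.symm
  have h2 : (h * g₀)⁻¹ * g ∈ K.fixingSubgroup := by
    rw [IntermediateField.mem_fixingSubgroup_iff]
    intro x hx
    have := hfh (A.ιK ⟨x, hx⟩)
    rw [hg, hg₀] at this
    change (h * g₀).symm (g x) = x
    rw [AlgEquiv.symm_apply_eq]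
    exact this
  exact (DoubleCoset.eq _ _ _ _).mpr ⟨h, h1, _, h2, by group⟩

/-- `Kˣ` is the group of `H`-fixed elements of the `G`-module `Ωˣ`, where `H` fixes `K`. -/
def unitsEquivFixed (K : IntermediateField ℚ Ω) :
    (K)ˣ ≃* FixedPoints.subgroup K.fixingSubgroup Ωˣ :=
  MulEquiv.ofBijective
    ((Units.map (algebraMap K Ω : K →* Ω)).codRestrict _ (fun x =>
      (FixedPoints.mem_subgroup _ _ _).mpr fun g =>
        Units.ext (((IntermediateField.mem_fixingSubgroup_iff K _).mp g.2) _ (x : K).2)))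
    ⟨fun x y h => Units.map_injective (algebraMap K Ω).injective (congrArg Subtype.val h),
      fun x => by
        have hx : ((x : Ωˣ) : Ω) ∈ K := by
          have h : ((x : Ωˣ) : Ω) ∈ IntermediateField.fixedField K.fixingSubgroup :=
            (IntermediateField.mem_fixedField_iff _ _).mpr
              fun g hg => congrArg Units.val (x.2 ⟨g, hg⟩)
          exact (IsGalois.fixedField_fixingSubgroup K).le h
        refine ⟨Units.mk0 ⟨_, hx⟩ (fun h => (x : Ωˣ).ne_zero (congrArg Subtype.val h)), ?_⟩
        exact Subtype.ext (Units.ext rfl)⟩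

/-- The action `x ↦ A · x` of a compositum `A` of `K` and `L`, from `Kˣ` to `Lˣ`: the operator
of the double coset attached to `A` on the `G`-module `Ωˣ`, from `(Ωˣ)^H = Kˣ` to
`(Ωˣ)^J = Lˣ`. -/
def action : (K)ˣ →* (L)ˣ :=
  (unitsEquivFixed L).symm.toMonoidHom.comp
    ((heckeOperator L.fixingSubgroup K.fixingSubgroup A.doubleCoset).comp
      (unitsEquivFixed K).toMonoidHom)

end Action

end Compositum

/-! ### Sets of primes and `S`-units -/

/-- `S` contains, with a prime of `K`, all primes of `K` above the same prime number. -/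
def IsSaturated {K : Type*} [Field K] (S : Set (HeightOneSpectrum (𝓞 K))) : Prop :=
  ∀ v ∈ S, ∀ w : HeightOneSpectrum (𝓞 K), w.asIdeal.under ℤ = v.asIdeal.under ℤ → w ∈ S

/-- The primes of `F` that lie above the same prime numbers as the elements of `S`. -/
def primesOverSame {K : Type*} [Field K] (S : Set (HeightOneSpectrum (𝓞 K)))
    (F : Type*) [Field F] : Set (HeightOneSpectrum (𝓞 F)) :=
  {w | ∃ v ∈ S, w.asIdeal.under ℤ = v.asIdeal.under ℤ}

open scoped Classical in
/-- The map `⨁ i, ⨁ A ∈ 𝒞 i, O_{L i, S}^× → K^×` that sends the component of index `(i, A)`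
through the action of the compositum `A`. The groups are written additively. -/
def compositumMap {Ω : Type u} [Field Ω] [NumberField Ω] [IsGalois ℚ Ω]
    (K : IntermediateField ℚ Ω) {ℓ : ℕ} (L : Fin ℓ → IntermediateField ℚ Ω)
    (𝒞 : ∀ i, Set (Compositum (L i) K)) (S : Set (HeightOneSpectrum (𝓞 K))) :
    (⨁ p : Σ i, 𝒞 i, Additive ((primesOverSame S (L p.1)).unit (L p.1))) →+ Additive (K)ˣ :=
  DirectSum.toAddMonoid fun p =>
    MonoidHom.toAdditive (p.2.1.action.comp ((primesOverSame S (L p.1)).unit (L p.1)).subtype)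

end

/-! Multiply the relation on the left by `N_H` and clear denominators: in `ℤ[G]`, for some `n > 0`,
the element `n N_H²` is a sum of terms `N_H a N_J b`. Let both sides act on an `S`-unit `u` of `K`,
seen in `Ωˣ`. The left side gives the power of `u` with exponent `n |H|²`, as `u` is fixed by `H`.
On the right, `x = N_J b u` is a `J`-fixed `S`-unit, hence an `S`-unit of some `K_i`, and `a` is an
integral combination of `g ∈ G`. All `δ x` with `δ ⊆ HgJ` have the same image under `N_H`, so a
positive power of `N_H g x` is a power of the image of `x` under the operator of `HgJ`
(`nsmul_groupAlgebraAction_normElement_mul_of`). Every double coset comes from a compositum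
(`Compositum.exists_doubleCoset_eq`), so `N_H g x` has a positive power in the image of `Φ`.
Elements with this property form a subgroup closed under roots, `saturatedRange`, which absorbs all
exponents. -/

/-! ### The group algebra acting on a multiplicative module -/

section GroupAlgebra

variable {G : Type*} [Group G]

/-- An identity `z = ∑ i, a_i N_{J_i} b_i` over `ℚ` holds, up to a positive integral multiple,
over `ℤ`. -/
theorem AdmitsGenNormRelation.exists_nsmul_mem_closure [Finite G] {H : Subgroup G}
    {𝒥 : Set (Subgroup G)} (h : AdmitsGenNormRelation ℚ H 𝒥) :
    ∃ n : ℕ, 0 < n ∧ n • normElement ℤ H ∈ AddSubmonoid.closure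
      {z : MonoidAlgebra ℤ G | ∃ J ∈ 𝒥, ∃ a b, z = a * normElement ℤ J * b} := by
  obtain ⟨m, J, a, b, hJ, hH⟩ := h
  set φ := MonoidAlgebra.mapRingHom G (Int.castRingHom ℚ)
  have hφ : Function.Injective φ := fun x y hxy => by
    ext g
    have := congrArg (fun z => MonoidAlgebra.coeff z g) hxy
    simpa [φ] using this
  have hnorm (U : Subgroup G) : φ (normElement ℤ U) = normElement ℚ U := by
    have _ := Fintype.ofFinite U
    simp [normElement, finsum_eq_sum_of_fintype, φ]
  -- Common denominators exist because elements of `ℚ[G]` have finite support.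
  have hint (x : MonoidAlgebra ℚ G) : ∃ n : ℕ, 0 < n ∧ ∃ x', φ x' = n • x := by
    induction x using MonoidAlgebra.induction_linear with
    | zero => exact ⟨1, one_pos, 0, by simp⟩
    | add x y hx hy =>
      obtain ⟨n, hn, x', hx⟩ := hx
      obtain ⟨k, hk, y', hy⟩ := hy
      exact ⟨n * k, mul_pos hn hk, k • x' + n • y', by
        rw [map_add, map_nsmul, map_nsmul, hx, hy, smul_add, smul_smul, smul_smul, mul_comm k n]⟩
    | single g q =>
      refine ⟨q.den, q.den_pos, MonoidAlgebra.single g q.num, ?_⟩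
      rw [MonoidAlgebra.mapRingHom_single, MonoidAlgebra.smul_single, nsmul_eq_mul, mul_comm,
        Rat.mul_den_eq_num]
      rfl
  have key : ∃ n : ℕ, 0 < n ∧ ∃ z ∈ AddSubmonoid.closure
      {z : MonoidAlgebra ℤ G | ∃ J ∈ 𝒥, ∃ a b, z = a * normElement ℤ J * b},
      φ z = n • normElement ℚ H := by
    rw [hH]
    refine Finset.sum_induction _ (fun x => ∃ n : ℕ, 0 < n ∧ ∃ z ∈ AddSubmonoid.closure
      {z : MonoidAlgebra ℤ G | ∃ J ∈ 𝒥, ∃ a b, z = a * normElement ℤ J * b},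
      φ z = n • x) ?_ ⟨1, one_pos, 0, zero_mem _, by simp⟩ ?_
    · rintro x y ⟨n, hn, x', hxm, hx⟩ ⟨k, hk, y', hym, hy⟩
      exact ⟨n * k, mul_pos hn hk, k • x' + n • y',
        add_mem (nsmul_mem hxm k) (nsmul_mem hym n), by
        rw [map_add, map_nsmul, map_nsmul, hx, hy, smul_add, smul_smul, smul_smul, mul_comm k n]⟩
    · intro i _
      obtain ⟨n, hn, a', ha⟩ := hint (a i)
      obtain ⟨k, hk, b', hb⟩ := hint (b i)
      exact ⟨n * k, mul_pos hn hk, a' * normElement ℤ (J i) * b',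
        AddSubmonoid.subset_closure ⟨J i, (hJ i).1, a', b', rfl⟩, by
        rw [map_mul, map_mul, ha, hb, hnorm, smul_mul_assoc, smul_mul_smul_comm]⟩
  obtain ⟨n, hn, z, hz, hzn⟩ := key
  refine ⟨n, hn, ?_⟩
  rwa [← hφ (hzn.trans (by rw [map_nsmul, hnorm]) : φ z = φ (n • normElement ℤ H))]

variable {V : Type*} [CommGroup V] [MulDistribMulAction G V]

variable (G V) in
/-- The action of `ℤ[G]` on a `G`-module `V` written multiplicatively. -/
noncomputable abbrev groupAlgebraAction :
    MonoidAlgebra ℤ G →ₐ[ℤ] Module.End ℤ (Additive V) :=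
  (Representation.ofMulDistribMulAction G V).asAlgebraHom

theorem groupAlgebraAction_of (g : G) (x : Additive V) :
    groupAlgebraAction G V (MonoidAlgebra.of ℤ G g) x = Additive.ofMul (g • x.toMul) := by
  rw [groupAlgebraAction, Representation.asAlgebraHom_of]
  rfl

/-- The hypothesis concerns the translates of the single element `x`, so that `U` need not be
`G`-stable; this matters when `U` is a preimage of `saturatedRange`. -/
theorem groupAlgebraAction_mem (U : AddSubgroup (Additive V)) (z : MonoidAlgebra ℤ G)
    (x : Additive V) (h : ∀ g : G, Additive.ofMul (g • x.toMul) ∈ U) :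
    groupAlgebraAction G V z x ∈ U := by
  induction z using MonoidAlgebra.induction_linear with
  | zero => simp
  | add a b ha hb =>
    rw [map_add, LinearMap.add_apply]
    exact add_mem ha hb
  | single g n =>
    rw [groupAlgebraAction, Representation.asAlgebraHom_single]
    exact zsmul_mem (h g) n

variable [Finite G]

theorem groupAlgebraAction_normElement (H : Subgroup G) [Fintype H] (x : Additive V) :
    groupAlgebraAction G V (normElement ℤ H) x =
      Additive.ofMul (∏ h : H, (h : G) • x.toMul) := by
  rw [normElement, finsum_eq_sum_of_fintype, map_sum, LinearMap.sum_apply, ofMul_prod]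
  exact Finset.sum_congr rfl fun h _ => groupAlgebraAction_of _ _

theorem of_mul_normElement (H : Subgroup G) (h : H) :
    MonoidAlgebra.of ℤ G h * normElement ℤ H = normElement ℤ H := by
  have _ := Fintype.ofFinite H
  rw [normElement, finsum_eq_sum_of_fintype, Finset.mul_sum]
  refine Fintype.sum_equiv (Equiv.mulLeft h) _ _ fun k => ?_
  rw [← map_mul]
  rfl

theorem normElement_mul_of (H : Subgroup G) (h : H) :
    normElement ℤ H * MonoidAlgebra.of ℤ G h = normElement ℤ H := by
  have _ := Fintype.ofFinite H
  rw [normElement, finsum_eq_sum_of_fintype, Finset.sum_mul]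
  refine Fintype.sum_equiv (Equiv.mulRight h) _ _ fun k => ?_
  rw [← map_mul]
  rfl

theorem groupAlgebraAction_normElement_of_fixed (H : Subgroup G) (x : FixedPoints.subgroup H V) :
    groupAlgebraAction G V (normElement ℤ H) (Additive.ofMul (x : V)) =
      Nat.card H • Additive.ofMul (x : V) := by
  have _ := Fintype.ofFinite H
  have h (h : H) : (h : G) • (Additive.ofMul (x : V)).toMul = (x : V) := x.2 h
  rw [groupAlgebraAction_normElement, Finset.prod_congr rfl fun k _ => h k, Finset.prod_const, Finset.card_univ, Nat.card_eq_fintype_card]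
  rfl

theorem groupAlgebraAction_normElement_mem_fixed (H : Subgroup G) (x : Additive V) :
    (groupAlgebraAction G V (normElement ℤ H) x).toMul ∈ FixedPoints.subgroup H V := by
  rw [FixedPoints.mem_subgroup]
  intro h
  change Additive.toMul (Additive.ofMul
    ((h : G) • (groupAlgebraAction G V (normElement ℤ H) x).toMul)) = _
  rw [← groupAlgebraAction_of, ← Module.End.mul_apply, ← map_mul, of_mul_normElement]

/-- Up to exponents, `N_H g` acts on `J`-fixed elements as the operator of `H g J`. -/
theorem nsmul_groupAlgebraAction_normElement_mul_of (H J : Subgroup G) (g : G)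
    (x : FixedPoints.subgroup J V) :
    Nat.card {δ : G ⧸ J // cosetToDoubleCoset H J δ = DoubleCoset.mk H J g} •
      groupAlgebraAction G V (normElement ℤ H) (Additive.ofMul (g • (x : V))) =
    Nat.card H • Additive.ofMul (heckeOperator H J (DoubleCoset.mk H J g) x : V) := by
  -- The value of the operator is `H`-fixed, so its multiple by `|H|` is its image under `N_H`,
  -- which is then computed coset by coset.
  rw [← groupAlgebraAction_normElement_of_fixed]
  have _ := Fintype.ofFinite {δ : G ⧸ J // cosetToDoubleCoset H J δ = DoubleCoset.mk H J g}
  change _ = groupAlgebraAction G V (normElement ℤ H) (Additive.ofMul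
    (∏ᶠ δ : {δ : G ⧸ J // cosetToDoubleCoset H J δ = DoubleCoset.mk H J g}, cosetSMul J x δ.1))
  rw [finprod_eq_prod_of_fintype, ofMul_prod, map_sum, Nat.card_eq_fintype_card,
    ← Finset.card_univ, ← Finset.sum_const]
  refine Finset.sum_congr rfl fun δ _ => ?_
  obtain ⟨δ, hδ⟩ := δ
  induction δ using QuotientGroup.induction_on with
  | H a =>
    -- With `a = h g j`, the factor `j` fixes `x` and `N_H h = N_H`.
    obtain ⟨h, hh, j, hj, e⟩ := (DoubleCoset.eq H J g a).mp hδ.symm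
    have hx : j • (x : V) = x := x.2 ⟨j, hj⟩
    rw [cosetSMul_mk, e, mul_smul, mul_smul, hx]
    change _ = groupAlgebraAction G V _ (Additive.ofMul (h • (Additive.ofMul (g • (x : V))).toMul))
    rw [← groupAlgebraAction_of, ← Module.End.mul_apply, ← map_mul,
      normElement_mul_of H ⟨h, hh⟩]

end GroupAlgebra

/-! ### Existence of compositums with a given double coset -/

namespace Compositum

section

variable {Ω : Type u} [Field Ω] [NumberField Ω] [IsGalois ℚ Ω] {K L : IntermediateField ℚ Ω}

/-- The witness is the subfield `g(K) L` of `Ω`, with `K` embedded through `g` and `L` by inclusion.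
-/
theorem exists_doubleCoset_eq (g : Ω ≃ₐ[ℚ] Ω) : ∃ A : Compositum K L,
    A.doubleCoset = DoubleCoset.mk L.fixingSubgroup K.fixingSubgroup g := by
  let C : IntermediateField ℚ Ω := K.map (g : Ω →ₐ[ℚ] Ω) ⊔ L
  let i : K →+* C := ((g : Ω →ₐ[ℚ] Ω).comp K.val).toRingHom.codRestrict C fun x =>
    (le_sup_left : K.map (g : Ω →ₐ[ℚ] Ω) ≤ C) ⟨x, x.2, rfl⟩
  let j : L →+* C := (IntermediateField.inclusion (le_sup_right : L ≤ C)).toRingHom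
  let A : Compositum K L :=
    { C := C
      ιK := i.toRatAlgHom
      ιL := j.toRatAlgHom
      generates := by
        rw [eq_top_iff]
        rintro ⟨x, hx⟩ -
        -- The extensions are algebraic, so the `ℚ`-algebra generated by `g(K)` and `L` is already
        -- the field `g(K) L`.
        have hx' : x ∈ Algebra.adjoin ℚ ((K.map (g : Ω →ₐ[ℚ] Ω) : Set Ω) ∪ L) := by
          have h : x ∈ (K.map (g : Ω →ₐ[ℚ] Ω) ⊔ L).toSubalgebra := hx
          rwa [IntermediateField.sup_toSubalgebra_of_isAlgebraic _ _ (Or.inl inferInstance),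
            ← Algebra.adjoin_eq (K.map (g : Ω →ₐ[ℚ] Ω)).toSubalgebra,
            ← Algebra.adjoin_eq L.toSubalgebra, ← Algebra.adjoin_union] at h
        suffices h : x ∈ (Subring.closure (Set.range i ∪ Set.range j)).map
            (C.val.toRingHom : C →+* Ω) by
          obtain ⟨y, hy, rfl⟩ := h
          exact hy
        have hL (y : L) : (y : Ω) ∈ (Subring.closure (Set.range i ∪ Set.range j)).map
            (C.val.toRingHom : C →+* Ω) :=
          ⟨j y, Subring.subset_closure (Or.inr ⟨y, rfl⟩), rfl⟩
        clear hx
        induction hx' using Algebra.adjoin_induction with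
        | mem y hy =>
          rcases hy with ⟨k, hk, rfl⟩ | hy
          · exact ⟨i ⟨k, hk⟩, Subring.subset_closure (Or.inl ⟨_, rfl⟩), rfl⟩
          · exact hL ⟨y, hy⟩
        -- Rational scalars lie in `L`, so the generated subring is a `ℚ`-algebra.
        | algebraMap q => exact hL (algebraMap ℚ L q)
        | add y z hy hz h1 h2 => exact add_mem h1 h2
        | mul y z hy hz h1 h2 => exact mul_mem h1 h2 }
  let f : A.C →ₐ[ℚ] Ω := C.val.toRingHom.toRatAlgHom
  exact ⟨A, A.doubleCoset_eq f (fun _ => rfl) g (fun _ => rfl)⟩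

theorem IsIso.doubleCoset_eq {A B : Compositum K L} (h : A.IsIso B) :
    A.doubleCoset = B.doubleCoset := by
  obtain ⟨e, hK, hL⟩ := h
  obtain ⟨g, f, hf, hg⟩ := B.exists_embedding_eq
  rw [B.doubleCoset_eq f hf g hg]
  refine A.doubleCoset_eq (f.comp e.toRingHom.toRatAlgHom) (fun y => ?_) g (fun x => ?_)
  · exact (congrArg f (hL y)).trans (hf y)
  · exact (congrArg f (hK x)).trans (hg x)

theorem IsSetOfRepresentatives.exists_doubleCoset_eq {𝒞 : Set (Compositum K L)}
    (h𝒞 : IsSetOfRepresentatives 𝒞) (g : Ω ≃ₐ[ℚ] Ω) : ∃ A ∈ 𝒞,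
    A.doubleCoset = DoubleCoset.mk L.fixingSubgroup K.fixingSubgroup g := by
  obtain ⟨A, hA⟩ := Compositum.exists_doubleCoset_eq (K := K) (L := L) g
  obtain ⟨B, hB, -⟩ := h𝒞 A
  exact ⟨B, hB.1, hB.2.doubleCoset_eq.symm.trans hA⟩

theorem coe_action (A : Compositum K L) (x : (K)ˣ) :
    Units.map (algebraMap L Ω : L →* Ω) (A.action x) =
      heckeOperator L.fixingSubgroup K.fixingSubgroup A.doubleCoset (unitsEquivFixed K x) :=
  congrArg Subtype.val ((unitsEquivFixed L).apply_symm_apply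
    (heckeOperator L.fixingSubgroup K.fixingSubgroup A.doubleCoset (unitsEquivFixed K x)))

end

end Compositum

/-! ### Units away from a set of primes under embeddings of number fields -/

section SUnit

variable {F E : Type*} [Field F] [NumberField F] [Field E] [NumberField E]

/-- The valuation at `w` restricts to the power of the valuation at `v` given by the ramification
index, which is nonzero. -/
theorem valuation_eq_one_iff_of_liesOver [Algebra F E] (v : HeightOneSpectrum (𝓞 F))
    (w : HeightOneSpectrum (𝓞 E)) [w.asIdeal.LiesOver v.asIdeal] (x : F) :
    v.valuation F x = 1 ↔ w.valuation E (algebraMap F E x) = 1 := by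
  rw [← HeightOneSpectrum.valuation_liesOver E v w x,
    pow_eq_one_iff_left
      (Ideal.IsDedekindDomain.ramificationIdx'_ne_zero_of_liesOver w.asIdeal v.ne_bot)]

/-- Taking an arbitrary ring morphism `f` covers both inclusions of subfields and automorphisms of
`Ω`. -/
theorem exists_under_valuation_eq_one_iff (f : F →+* E) (w : HeightOneSpectrum (𝓞 E)) :
    ∃ v : HeightOneSpectrum (𝓞 F), v.asIdeal.under ℤ = w.asIdeal.under ℤ ∧
      ∀ x : F, v.valuation F x = 1 ↔ w.valuation E (f x) = 1 := by
  let _ : Algebra F E := f.toAlgebra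
  have _ : w.asIdeal.LiesOver (w.under (𝓞 F)).asIdeal := ⟨rfl⟩
  exact ⟨w.under (𝓞 F), by rw [HeightOneSpectrum.under_asIdeal, Ideal.under_under],
    valuation_eq_one_iff_of_liesOver _ w⟩

theorem exists_over_valuation_eq_one_iff (f : F →+* E) (v : HeightOneSpectrum (𝓞 F)) :
    ∃ w : HeightOneSpectrum (𝓞 E), v.asIdeal.under ℤ = w.asIdeal.under ℤ ∧
      ∀ x : F, v.valuation F x = 1 ↔ w.valuation E (f x) = 1 := by
  let _ : Algebra F E := f.toAlgebra
  have _ := v.isMaximal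
  obtain ⟨P, hP, hPv⟩ := Ideal.exists_maximal_ideal_liesOver_of_isIntegral (S := 𝓞 E) v.asIdeal
  let w : HeightOneSpectrum (𝓞 E) := ⟨P, hP.isPrime, Ideal.ne_bot_of_liesOver_of_ne_bot v.ne_bot P⟩
  have _ : w.asIdeal.LiesOver v.asIdeal := hPv
  exact ⟨w, by rw [hPv.over, Ideal.under_under], valuation_eq_one_iff_of_liesOver v w⟩

/-- A unit of `F` is a unit away from the primes over those below `S` as soon as its image in
`E` is one, and conversely. -/
theorem mem_unit_primesOverSame_iff {K : Type*} [Field K] (S : Set (HeightOneSpectrum (𝓞 K)))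
    (f : F →+* E) (x : Fˣ) :
    Units.map (f : F →* E) x ∈ (primesOverSame S E).unit E ↔ x ∈ (primesOverSame S F).unit F := by
  constructor
  · intro h v hv
    obtain ⟨w, hvw, hw⟩ := exists_over_valuation_eq_one_iff f v
    refine (hw x).mpr (h w fun ⟨s, hs, hws⟩ => hv ⟨s, hs, hvw.trans hws⟩)
  · intro h w hw
    obtain ⟨v, hvw, hv⟩ := exists_under_valuation_eq_one_iff f w
    exact (hv x).mp (h v fun ⟨s, hs, hvs⟩ => hw ⟨s, hs, hvw.symm.trans hvs⟩)

theorem IsSaturated.primesOverSame_eq {F : Type*} [Field F]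
    {S : Set (HeightOneSpectrum (𝓞 F))} (hS : IsSaturated S) :
    primesOverSame S F = S :=
  Set.ext fun w => ⟨fun ⟨v, hv, h⟩ => hS v hv w h, fun hw => ⟨w, hw, rfl⟩⟩

end SUnit

/-! ### Ranks -/

/-- The quotient `B / A` is torsion, hence of rank zero, and rank is additive. -/
theorem AddSubgroup.rank_eq_of_forall_nsmul_mem {M : Type*} [AddCommGroup M]
    {A B : AddSubgroup M} (hAB : A ≤ B) (h : ∀ b ∈ B, ∃ n : ℕ, 0 < n ∧ n • b ∈ A) :
    Module.rank ℤ A = Module.rank ℤ B := by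
  let f : A →ₗ[ℤ] B := (AddSubgroup.inclusion hAB).toIntLinearMap
  have hf : Function.Injective f := AddSubgroup.inclusion_injective hAB
  have htors : Module.IsTorsion ℤ (B ⧸ LinearMap.range f) := by
    intro x
    obtain ⟨b, rfl⟩ := Submodule.Quotient.mk_surjective (LinearMap.range f) x
    obtain ⟨n, hn, hb⟩ := h b b.2
    refine ⟨⟨(n : ℤ), mem_nonZeroDivisors_of_ne_zero (by exact_mod_cast hn.ne')⟩, ?_⟩
    change (n : ℤ) • Submodule.Quotient.mk (p := LinearMap.range f) b = 0
    rw [← Submodule.Quotient.mk_smul, Submodule.Quotient.mk_eq_zero]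
    exact ⟨⟨n • (b : M), hb⟩, Subtype.ext (by simp [f])⟩
  rw [← rank_quotient_add_rank_of_isDomain (LinearMap.range f),
    Module.rank_eq_zero_iff_isTorsion.mpr htors, zero_add]
  exact (LinearEquiv.ofInjective f hf).rank_eq

/-! ### The image of the compositums -/

section Main

variable {Ω : Type u} [Field Ω] [NumberField Ω] [IsGalois ℚ Ω]
  (K : IntermediateField ℚ Ω) {ℓ : ℕ} (L : Fin ℓ → IntermediateField ℚ Ω)
  (𝒞 : ∀ i, Set (Compositum (L i) K)) (S : Set (HeightOneSpectrum (𝓞 K)))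

omit [IsGalois ℚ Ω] in
theorem smul_mem_unit_primesOverSame (g : Ω ≃ₐ[ℚ] Ω) {x : Ωˣ}
    (hx : x ∈ (primesOverSame S Ω).unit Ω) : g • x ∈ (primesOverSame S Ω).unit Ω := by
  have h : g • x = Units.map ((g : Ω →+* Ω) : Ω →* Ω) x := Units.ext rfl
  rw [h]
  exact (mem_unit_primesOverSame_iff S _ x).mpr hx

variable {K} in
-- Being an `S`-unit can be tested in `Ω`, where `A · x` is a product of conjugates of `x`.
theorem Compositum.action_mem_unit {L : IntermediateField ℚ Ω} (A : Compositum L K) {x : Lˣ}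
    (hx : x ∈ (primesOverSame S L).unit L) : A.action x ∈ (primesOverSame S K).unit K := by
  rw [← mem_unit_primesOverSame_iff S (algebraMap K Ω)]
  change Units.map (algebraMap K Ω : K →* Ω) (A.action x) ∈ _
  rw [A.coe_action]
  refine finprod_induction (· ∈ (primesOverSame S Ω).unit Ω) (one_mem _)
    (fun _ _ => mul_mem) fun δ => ?_
  obtain ⟨δ, -⟩ := δ
  induction δ using QuotientGroup.induction_on with
  | H g =>
    exact smul_mem_unit_primesOverSame K S g
      ((mem_unit_primesOverSame_iff S (algebraMap L Ω) x).mpr hx)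

theorem action_mem_range_compositumMap {i : Fin ℓ} {A : Compositum (L i) K} (hA : A ∈ 𝒞 i)
    {x : (L i)ˣ} (hx : x ∈ (primesOverSame S (L i)).unit (L i)) :
    Additive.ofMul (A.action x) ∈ (compositumMap K L 𝒞 S).range := by
  classical
  refine ⟨DirectSum.of (fun p : Σ i, 𝒞 i =>
    Additive ((primesOverSame S (L p.1)).unit (L p.1))) ⟨i, A, hA⟩ (Additive.ofMul ⟨x, hx⟩), ?_⟩
  rw [compositumMap]
  convert DirectSum.toAddMonoid_of _ _ _
  rfl

theorem range_compositumMap_le :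
    (compositumMap K L 𝒞 S).range ≤ Subgroup.toAddSubgroup ((primesOverSame S K).unit K) := by
  classical
  rintro _ ⟨x, rfl⟩
  induction x using DirectSum.induction_on with
  | zero => rw [map_zero]; exact zero_mem _
  | add x y hx hy => rw [map_add]; exact add_mem hx hy
  | of p x =>
    have h : compositumMap K L 𝒞 S (DirectSum.of (fun p : Σ i, 𝒞 i =>
        Additive ((primesOverSame S (L p.1)).unit (L p.1))) p x) =
        Additive.ofMul (p.2.1.action x.toMul) := by
      rw [compositumMap]
      convert DirectSum.toAddMonoid_of _ _ _
      rfl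
    rw [h]
    exact p.2.1.action_mem_unit S x.toMul.2

/-- The elements of `Ωˣ` with a positive power in the image of the compositums. -/
def saturatedRange : AddSubgroup (Additive Ωˣ) where
  carrier := {t | ∃ n : ℕ, 0 < n ∧ ∃ y, Additive.ofMul y ∈ (compositumMap K L 𝒞 S).range ∧
    n • t = Additive.ofMul (Units.map (algebraMap K Ω : K →* Ω) y)}
  zero_mem' := ⟨1, one_pos, 1, zero_mem _, by rw [map_one, smul_zero]; rfl⟩
  add_mem' := by
    rintro s t ⟨n, hn, y, hy, hs⟩ ⟨k, hk, z, hz, ht⟩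
    refine ⟨n * k, mul_pos hn hk, y ^ k * z ^ n, add_mem (nsmul_mem hy k) (nsmul_mem hz n), ?_⟩
    rw [map_mul, map_pow, map_pow, ofMul_mul, ofMul_pow, ofMul_pow, ← hs, ← ht, nsmul_add,
      smul_smul, smul_smul, mul_comm k n]
  neg_mem' := by
    rintro s ⟨n, hn, y, hy, hs⟩
    exact ⟨n, hn, y⁻¹, neg_mem hy, by rw [neg_nsmul, hs, map_inv]; rfl⟩

theorem mem_saturatedRange_of_nsmul_mem {n : ℕ} (hn : 0 < n) {t : Additive Ωˣ}
    (h : n • t ∈ saturatedRange K L 𝒞 S) : t ∈ saturatedRange K L 𝒞 S := by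
  obtain ⟨k, hk, y, hy, e⟩ := h
  exact ⟨k * n, mul_pos hk hn, y, hy, by rw [← e, smul_smul]⟩

variable {L 𝒞}

theorem normElement_of_mem_saturatedRange
    (h𝒞 : ∀ i, Compositum.IsSetOfRepresentatives (𝒞 i)) {i : Fin ℓ} {x : Ωˣ}
    (hx : x ∈ (primesOverSame S Ω).unit Ω)
    (hxf : x ∈ FixedPoints.subgroup (L i).fixingSubgroup Ωˣ) (g : Ω ≃ₐ[ℚ] Ω) :
    groupAlgebraAction (Ω ≃ₐ[ℚ] Ω) Ωˣ (normElement ℤ K.fixingSubgroup) (Additive.ofMul (g • x)) ∈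
      saturatedRange K L 𝒞 S := by
  obtain ⟨A, hA, hAg⟩ := (h𝒞 i).exists_doubleCoset_eq g
  have hpos : 0 < Nat.card {δ : (Ω ≃ₐ[ℚ] Ω) ⧸ (L i).fixingSubgroup //
      cosetToDoubleCoset K.fixingSubgroup (L i).fixingSubgroup δ =
        DoubleCoset.mk K.fixingSubgroup (L i).fixingSubgroup g} :=
    -- The coset of `g` itself lies in the double coset.
    Nat.card_pos_iff.mpr ⟨⟨⟨g, rfl⟩⟩, inferInstance⟩
  refine mem_saturatedRange_of_nsmul_mem K L 𝒞 S hpos ?_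
  rw [nsmul_groupAlgebraAction_normElement_mul_of K.fixingSubgroup (L i).fixingSubgroup g ⟨x, hxf⟩]
  obtain ⟨y, hy⟩ := (Compositum.unitsEquivFixed (L i)).surjective ⟨x, hxf⟩
  have hyx : Units.map (algebraMap (L i) Ω : L i →* Ω) y = x := congrArg Subtype.val hy
  have hyS : y ∈ (primesOverSame S (L i)).unit (L i) := by
    rw [← mem_unit_primesOverSame_iff S (algebraMap (L i) Ω)]
    exact hyx.symm ▸ hx
  have hmem : Additive.ofMul (Units.map (algebraMap K Ω : K →* Ω) (A.action y)) ∈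
      saturatedRange K L 𝒞 S :=
    ⟨1, one_pos, A.action y, action_mem_range_compositumMap K L 𝒞 S hA hyS, one_smul _ _⟩
  rw [A.coe_action, hy, hAg] at hmem
  exact nsmul_mem hmem _

/-- For `z = a N_J b`, the element `N_J b x` is a `J`-fixed `S`-unit; expanding `a` over `G` reduces
to `normElement_of_mem_saturatedRange`. -/
theorem normElement_mul_mem_saturatedRange
    (h𝒞 : ∀ i, Compositum.IsSetOfRepresentatives (𝒞 i)) {z : MonoidAlgebra ℤ (Ω ≃ₐ[ℚ] Ω)}
    (hz : z ∈ AddSubmonoid.closure {z : MonoidAlgebra ℤ (Ω ≃ₐ[ℚ] Ω) |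
      ∃ J ∈ Set.range fun i => (L i).fixingSubgroup, ∃ a b, z = a * normElement ℤ J * b})
    {x : Ωˣ} (hx : x ∈ (primesOverSame S Ω).unit Ω) :
    groupAlgebraAction (Ω ≃ₐ[ℚ] Ω) Ωˣ (normElement ℤ K.fixingSubgroup * z) (Additive.ofMul x) ∈
      saturatedRange K L 𝒞 S := by
  induction hz using AddSubmonoid.closure_induction with
  | zero => rw [mul_zero, map_zero]; exact zero_mem _
  | add z w _ _ hz hw => rw [mul_add, map_add]; exact add_mem hz hw
  | mem z hz =>
    obtain ⟨_, ⟨i, rfl⟩, a, b, rfl⟩ := hz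
    have hU (c : MonoidAlgebra ℤ (Ω ≃ₐ[ℚ] Ω)) {t : Ωˣ} (ht : t ∈ (primesOverSame S Ω).unit Ω) :
        groupAlgebraAction (Ω ≃ₐ[ℚ] Ω) Ωˣ c (Additive.ofMul t) ∈
          Subgroup.toAddSubgroup ((primesOverSame S Ω).unit Ω) :=
      groupAlgebraAction_mem _ c _ fun g => smul_mem_unit_primesOverSame K S g ht
    rw [mul_assoc a, map_mul, Module.End.mul_apply, map_mul, Module.End.mul_apply]
    refine groupAlgebraAction_mem ((saturatedRange K L 𝒞 S).comap (groupAlgebraAction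
      (Ω ≃ₐ[ℚ] Ω) Ωˣ (normElement ℤ K.fixingSubgroup)).toAddMonoidHom) a _ fun g => ?_
    refine normElement_of_mem_saturatedRange K S h𝒞 (i := i) (hU _ hx) ?_ g
    rw [map_mul, Module.End.mul_apply]
    exact groupAlgebraAction_normElement_mem_fixed _ _

theorem exists_pow_mem_range_compositumMap
    (hrel : AdmitsGenNormRelation ℚ K.fixingSubgroup
      (Set.range fun i => (L i).fixingSubgroup))
    (h𝒞 : ∀ i, Compositum.IsSetOfRepresentatives (𝒞 i))
    {u : (K)ˣ} (hu : u ∈ (primesOverSame S K).unit K) :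
    ∃ n : ℕ, 0 < n ∧ Additive.ofMul (u ^ n) ∈ (compositumMap K L 𝒞 S).range := by
  obtain ⟨n, hn, hz⟩ := hrel.exists_nsmul_mem_closure
  have h := normElement_mul_mem_saturatedRange K S h𝒞 hz
    ((mem_unit_primesOverSame_iff S (algebraMap K Ω) u).mpr hu)
  have hfix := groupAlgebraAction_normElement_of_fixed K.fixingSubgroup
    (Compositum.unitsEquivFixed K u)
  have hcard : 0 < Nat.card K.fixingSubgroup := Nat.card_pos
  -- Each of the two factors `N_H` in `N_H (n N_H)` contributes `|H|` to the exponent.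
  have h' : (n * (Nat.card K.fixingSubgroup * Nat.card K.fixingSubgroup)) •
      Additive.ofMul ((Compositum.unitsEquivFixed K u : Ωˣ)) ∈ saturatedRange K L 𝒞 S := by
    convert h using 1
    change _ = groupAlgebraAction _ _ _ (Additive.ofMul (Compositum.unitsEquivFixed K u : Ωˣ))
    rw [mul_smul_comm, map_nsmul, LinearMap.smul_apply, map_mul, Module.End.mul_apply, hfix,
      map_nsmul, hfix, smul_smul, smul_smul, mul_assoc]
  obtain ⟨k, hk, y, hy, e⟩ := mem_saturatedRange_of_nsmul_mem K L 𝒞 S (by positivity) h'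
  refine ⟨k, hk, ?_⟩
  have huy : u ^ k = y := Units.map_injective (f := (algebraMap K Ω : K →* Ω))
    (algebraMap K Ω).injective (by rw [map_pow]; exact congrArg Additive.toMul e)
  rwa [huy]

end Main

theorem mainTheorem10 {Ω : Type u} [Field Ω] [NumberField Ω] [IsGalois ℚ Ω]
    (K : IntermediateField ℚ Ω) {ℓ : ℕ} (L : Fin ℓ → IntermediateField ℚ Ω)
    (hrel : AdmitsGenNormRelation ℚ K.fixingSubgroup
      (Set.range fun i => (L i).fixingSubgroup))
    (𝒞 : ∀ i, Set (Compositum (L i) K))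
    (h𝒞 : ∀ i, Compositum.IsSetOfRepresentatives (𝒞 i))
    (S : Set (HeightOneSpectrum (𝓞 K))) (hS : IsSaturated S) :
    (compositumMap K L 𝒞 S).range ≤ Subgroup.toAddSubgroup (S.unit K) ∧
    Module.rank ℤ (compositumMap K L 𝒞 S).range =
      Module.rank ℤ (Subgroup.toAddSubgroup (S.unit K)) ∧
    ∀ u ∈ S.unit K, ∃ n : ℕ, 0 < n ∧
      Additive.ofMul (u ^ n) ∈ (compositumMap K L 𝒞 S).range := by
  have hle := range_compositumMap_le K L 𝒞 S
  have hpow := fun u hu => exists_pow_mem_range_compositumMap K S hrel h𝒞 (u := u) hu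
  -- Saturation of `S` enters here: the primes of `K` over those below `S` are exactly the elements
  -- of `S`.
  rw [hS.primesOverSame_eq] at hle hpow
  exact ⟨hle, AddSubgroup.rank_eq_of_forall_nsmul_mem hle fun u hu => hpow u.toMul hu, hpow⟩
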